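/- For a partition $\lambda$ of a nonnegative integer, define its rank to be the largest part of $\lambda$ minus the number of parts of $\lambda$. Define its crank to be the largest part of $\lambda$ if $1$ is not a part of $\lambda$, and $e(k)-k$ if $1$ occurs exactly $k\ge 1$ times as a part of $\lambda$, where $e(k)$ is the number of parts of $\lambda$ strictly larger than $k$. The empty partition (the only partition of $0$) has rank $0$ and crank $0$. For integers $m$ and $n\ge 0$, let $N(m,n)$ be the number of partitions of $n$ with rank $m$. For $n\neq 1$ let $M(m,n)$ be the number of partitions of $n$ with crank $m$, and for $n=1$ set $M(0,1)=-1$, $M(-1,1)=M(1,1)=1$ and $M(m,1)=0$ for all other $m$. Let $p_3(n)$ be the number of partitions of $n$ all of whose parts are congruent to $\pm1$ modulo $3$ (so $p_3(0)=1$). Then for every integer $m$ and every integer $n\ge 0$, $$N(3m-1,n)+N(3m,n)+N(3m+1,n)=\sum_{0\le 3k\le n} M(m,k)\,p_3(n-3k),$$ where the sum runs over the integers $k$ with $0\le 3k\le n$. -/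

import Mathlib

/-- The largest part of a partition; the empty partition has largest part `0`. -/
def Nat.Partition.largestPart {n : ℕ} (p : n.Partition) : ℕ := p.parts.sup

/-- Dyson's rank of a partition: the largest part minus the number of parts. -/
def Nat.Partition.dysonRank {n : ℕ} (p : n.Partition) : ℤ :=
  (p.largestPart : ℤ) - (p.parts.card : ℤ)

/-- The Andrews–Garvan crank of a partition: the largest part if `1` is not a part; otherwise
`e(k) - k`, where `k` is the number of parts equal to `1` and `e(k)` is the number of parts
strictly larger than `k`. -/
def Nat.Partition.crank {n : ℕ} (p : n.Partition) : ℤ :=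
  if 1 ∈ p.parts then
    ((p.parts.filter (fun i => p.parts.count 1 < i)).card : ℤ) - (p.parts.count 1 : ℤ)
  else
    (p.largestPart : ℤ)

/-- `N(m, n)`: the number of partitions of `n` with rank `m`. -/
def rankCount (m : ℤ) (n : ℕ) : ℕ :=
  (Finset.univ.filter (fun p : n.Partition => p.dysonRank = m)).card

/-- `M(m, n)`: the number of partitions of `n` with crank `m`, except that for `n = 1` one sets
`M(0, 1) = -1`, `M(-1, 1) = M(1, 1) = 1` and `M(m, 1) = 0` for all other `m`. -/
def crankCount (m : ℤ) (n : ℕ) : ℤ :=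
  if n = 1 then
    if m = 0 then -1 else if m = 1 ∨ m = -1 then 1 else 0
  else
    ((Finset.univ.filter (fun p : n.Partition => p.crank = m)).card : ℤ)

/-- `p₃(n)`: the number of partitions of `n` all of whose parts are congruent to `1` or `-1`
modulo `3`. -/
def pThree (n : ℕ) : ℕ :=
  (Nat.Partition.restricted n (fun i => (i : ℤ) ≡ 1 [ZMOD 3] ∨ (i : ℤ) ≡ -1 [ZMOD 3])).card

/-! Write `P` for the partition generating function and `A_m` for that of the partitions with rank
at least `3m - 1`. Removing the first column of a Young diagram and adding a row `c` cells longer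
than it maps rank at most `c + 1` to rank at least `c - 1` and raises the size by `c`
(`columnToRow_spec`, `rowToColumn_spec`). With `c = 3m`, passing to complements, this gives `A_m =
q^(3m) (P - A_(m+1))`.

On the crank side, sorting by the number of ones and by the number of larger parts gives the
generating function `C_d` of crank `±d` (`crankCount_natCast`, `crankCount_neg`). Durfee rectangle
identities yield `C_d = q^d G_d - q^(d+1) G_(d+1)` and `G_d = P - q^(d+1) G_(d+1)`, where `G_d` is
`gapSeries d`.

If `R` generates `p₃`, then `P(q) = R(q) P(q^3)`. Hence `R(q)` times `q^m G_m` taken at `q^3`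
satisfies the recurrence of `A_m`. That recurrence contracts `q`-adically, so its solution is unique
(`eq_of_recurrence`). Differences of consecutive tails give the theorem for `m ≥ 0`; for `m ≤ 0` the
lower rank tails satisfy the same recurrence. -/

open PowerSeries

/-! ### Generating functions of classes of partitions -/

/-- The multisets of positive integers with sum `n`. -/
def partitionFinset (n : ℕ) : Finset (Multiset ℕ) :=
  Finset.univ.image (fun p : n.Partition => p.parts)

theorem mem_partitionFinset {n : ℕ} {s : Multiset ℕ} :
    s ∈ partitionFinset n ↔ 0 ∉ s ∧ s.sum = n := by
  simp only [partitionFinset, Finset.mem_image, Finset.mem_univ, true_and]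
  constructor
  · rintro ⟨p, rfl⟩
    exact ⟨fun h => (p.parts_pos h).false, p.parts_sum⟩
  · rintro ⟨h0, hs⟩
    exact ⟨⟨s, fun {i} hi => Nat.pos_of_ne_zero (fun h => h0 (h ▸ hi)), hs⟩, rfl⟩

open Classical in
/-- The generating function of the partitions (as multisets of positive integers)
satisfying `Q`. -/
noncomputable def partitionSeries (Q : Multiset ℕ → Prop) : ℤ⟦X⟧ :=
  PowerSeries.mk fun n => (((partitionFinset n).filter Q).card : ℤ)

theorem card_filter_partition {n : ℕ} (Q : Multiset ℕ → Prop)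
    [DecidablePred fun p : n.Partition => Q p.parts] :
    ((Finset.univ.filter (fun p : n.Partition => Q p.parts)).card : ℤ) =
      coeff n (partitionSeries Q) := by
  classical
  rw [partitionSeries, coeff_mk, partitionFinset, Finset.filter_image, Finset.card_image_of_injective]
  · congr!
  · intro p q h
    exact Nat.Partition.ext h

namespace partitionSeries

theorem coeff_eq (Q : Multiset ℕ → Prop) [DecidablePred Q] (n : ℕ) :
    coeff n (partitionSeries Q) = (((partitionFinset n).filter Q).card : ℤ) := by
  rw [partitionSeries, coeff_mk]
  congr!

theorem congr {Q R : Multiset ℕ → Prop} (h : ∀ s, 0 ∉ s → (Q s ↔ R s)) :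
    partitionSeries Q = partitionSeries R := by
  classical
  ext n
  rw [coeff_eq, coeff_eq]
  congr 2
  apply Finset.filter_congr
  intro s hs
  exact h s (mem_partitionFinset.1 hs).1

theorem split (Q R : Multiset ℕ → Prop) :
    partitionSeries Q =
      partitionSeries (fun s => Q s ∧ R s) + partitionSeries (fun s => Q s ∧ ¬ R s) := by
  classical
  ext n
  rw [map_add, coeff_eq, coeff_eq, coeff_eq, ← Finset.filter_filter, ← Finset.filter_filter]
  exact_mod_cast (Finset.card_filter_add_card_filter_not _).symm

/-- A bijection raising the sum by `c` multiplies the generating function by `X ^ c`. -/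
theorem shift {Q R : Multiset ℕ → Prop} (c : ℕ) (f g : Multiset ℕ → Multiset ℕ)
    (hf : ∀ s, 0 ∉ s → Q s → 0 ∉ f s ∧ R (f s) ∧ (f s).sum = s.sum + c ∧ g (f s) = s)
    (hg : ∀ t, 0 ∉ t → R t → 0 ∉ g t ∧ Q (g t) ∧ (g t).sum + c = t.sum ∧ f (g t) = t) :
    partitionSeries R = X ^ c * partitionSeries Q := by
  classical
  ext n
  rw [coeff_X_pow_mul', coeff_eq]
  split_ifs with h
  · rw [coeff_eq]
    norm_cast
    refine Finset.card_nbij' g f ?_ ?_ ?_ ?_ <;>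
      simp only [Set.MapsTo, Set.LeftInvOn, Set.RightInvOn, Finset.mem_coe, Finset.mem_filter,
        mem_partitionFinset, and_imp]
    · intro t h0 hs hR
      obtain ⟨h1, h2, h3, -⟩ := hg t h0 hR
      exact ⟨⟨h1, by omega⟩, h2⟩
    · intro t h0 hs hR
      obtain ⟨h1, h2, h3, -⟩ := hf t h0 hR
      exact ⟨⟨h1, by omega⟩, h2⟩
    · intro t h0 hs hR
      exact (hg t h0 hR).2.2.2
    · intro t h0 hs hR
      exact (hf t h0 hR).2.2.2
  · norm_cast
    rw [Finset.card_eq_zero, Finset.filter_eq_empty_iff]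
    intro t ht hR
    rw [mem_partitionFinset] at ht
    have := (hg t ht.1 hR).2.2.1
    omega

theorem filter_add_of_forall {P : ℕ → Prop} [DecidablePred P] {a b : Multiset ℕ}
    (ha : ∀ x ∈ a, P x) (hb : ∀ x ∈ b, ¬ P x) :
    (a + b).filter P = a ∧ (a + b).filter (fun x => ¬ P x) = b := by
  rw [Multiset.filter_add, Multiset.filter_add, Multiset.filter_eq_self.2 ha,
    Multiset.filter_eq_nil.2 hb, Multiset.filter_eq_self.2 hb,
    Multiset.filter_eq_nil.2 fun x hx => not_not.2 (ha x hx)]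
  simp

/-- A partition is a free pair of its parts satisfying `P` and its remaining parts. -/
theorem mul (P : ℕ → Prop) [DecidablePred P] (A B : Multiset ℕ → Prop) :
    partitionSeries (fun s => A (s.filter P) ∧ B (s.filter fun x => ¬ P x)) =
      partitionSeries (fun s => (∀ x ∈ s, P x) ∧ A s) *
        partitionSeries (fun s => (∀ x ∈ s, ¬ P x) ∧ B s) := by
  classical
  ext n
  rw [coeff_mul, coeff_eq]
  simp only [coeff_eq]
  norm_cast
  simp only [← Finset.card_product]
  rw [← Finset.card_sigma]
  refine Finset.card_nbij'
    (fun s => ⟨((s.filter P).sum, (s.filter fun x => ¬ P x).sum),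
      (s.filter P, s.filter fun x => ¬ P x)⟩) (fun t => t.2.1 + t.2.2) ?_ ?_ ?_ ?_
  · intro s hs
    simp only [Finset.mem_coe, Finset.mem_filter, mem_partitionFinset] at hs
    obtain ⟨⟨h0, hs⟩, hA, hB⟩ := hs
    simp only [Finset.coe_sigma, Set.mem_sigma_iff, Finset.mem_coe,
      Finset.mem_product, Finset.mem_filter, mem_partitionFinset]
    refine ⟨?_, ⟨⟨fun h => h0 (Multiset.mem_of_mem_filter h), trivial⟩,
      fun x hx => (Multiset.mem_filter.1 hx).2, hA⟩,
      ⟨⟨fun h => h0 (Multiset.mem_of_mem_filter h), trivial⟩,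
      fun x hx => (Multiset.mem_filter.1 hx).2, hB⟩⟩
    rw [Finset.HasAntidiagonal.mem_antidiagonal, ← Multiset.sum_add, Multiset.filter_add_not, hs]
  · rintro ⟨⟨i, j⟩, a, b⟩ h
    simp only [Finset.coe_sigma, Set.mem_sigma_iff, Finset.mem_coe, Finset.mem_product,
      Finset.mem_filter, mem_partitionFinset] at h
    obtain ⟨hij, ⟨⟨ha0, hai⟩, haP, hA⟩, ⟨hb0, hbj⟩, hbP, hB⟩ := h
    rw [Finset.HasAntidiagonal.mem_antidiagonal] at hij
    obtain ⟨h1, h2⟩ := filter_add_of_forall haP hbP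
    simp only [Finset.mem_coe, Finset.mem_filter, mem_partitionFinset, h1, h2, Multiset.mem_add,
      Multiset.sum_add]
    exact ⟨⟨by tauto, by simp_all⟩, hA, hB⟩
  · intro s hs
    exact Multiset.filter_add_not P s
  · rintro ⟨⟨i, j⟩, a, b⟩ h
    simp only [Finset.coe_sigma, Set.mem_sigma_iff, Finset.mem_coe, Finset.mem_product,
      Finset.mem_filter, mem_partitionFinset] at h
    obtain ⟨hij, ⟨⟨ha0, rfl⟩, haP, hA⟩, ⟨hb0, rfl⟩, hbP, hB⟩ := h
    obtain ⟨h1, h2⟩ := filter_add_of_forall haP hbP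
    simp only [h1, h2]

theorem eq_one {Q : Multiset ℕ → Prop} (h : ∀ s, 0 ∉ s → (Q s ↔ s = 0)) :
    partitionSeries Q = 1 := by
  classical
  rw [congr h]
  ext n
  rw [coeff_eq, coeff_one, Finset.filter_eq']
  split_ifs with h1 h2 h2 <;> simp_all [mem_partitionFinset]

theorem eq_zero {Q : Multiset ℕ → Prop} (h : ∀ s, 0 ∉ s → ¬ Q s) : partitionSeries Q = 0 := by
  classical
  ext n
  rw [coeff_eq, map_zero, Nat.cast_eq_zero, Finset.card_eq_zero, Finset.filter_eq_empty_iff]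
  exact fun s hs => h s (mem_partitionFinset.1 hs).1

end partitionSeries

/-! ### Infinite sums of power series -/

/-- The sum of a family of power series whose `a`-th member is divisible by `X ^ a`. -/
noncomputable def diagSum (f : ℕ → ℤ⟦X⟧) : ℤ⟦X⟧ :=
  PowerSeries.mk fun n => ∑ a ∈ Finset.range (n + 1), coeff n (f a)

namespace diagSum

theorem add (f g : ℕ → ℤ⟦X⟧) : diagSum (fun a => f a + g a) = diagSum f + diagSum g := by
  ext n
  simp [diagSum, Finset.sum_add_distrib]

theorem sub (f g : ℕ → ℤ⟦X⟧) : diagSum (fun a => f a - g a) = diagSum f - diagSum g := by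
  ext n
  simp [diagSum, Finset.sum_sub_distrib]

theorem coeff_eq_sum {f : ℕ → ℤ⟦X⟧} (hf : ∀ a, X ^ a ∣ f a) {n k : ℕ} (h : n ≤ k) :
    coeff n (diagSum f) = ∑ a ∈ Finset.range (k + 1), coeff n (f a) := by
  rw [diagSum, coeff_mk]
  refine Finset.sum_subset (fun a ha => ?_) fun a _ ha => ?_
  · rw [Finset.mem_range] at *; omega
  · rw [Finset.mem_range] at ha
    exact X_pow_dvd_iff.1 (hf a) n (by omega)

theorem const_mul (c : ℤ⟦X⟧) {f : ℕ → ℤ⟦X⟧} (hf : ∀ a, X ^ a ∣ f a) :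
    diagSum (fun a => c * f a) = c * diagSum f := by
  ext n
  rw [coeff_mul, diagSum, coeff_mk]
  simp only [coeff_mul]
  rw [Finset.sum_comm]
  refine Finset.sum_congr rfl fun p hp => ?_
  rw [Finset.HasAntidiagonal.mem_antidiagonal] at hp
  rw [coeff_eq_sum hf (show p.2 ≤ n by omega), Finset.mul_sum]

theorem eq_head_add {f : ℕ → ℤ⟦X⟧} (hf : ∀ a, X ^ a ∣ f a) :
    diagSum f = f 0 + diagSum fun a => f (a + 1) := by
  ext n
  rw [map_add, coeff_eq_sum hf (Nat.le_succ n), Finset.sum_range_succ', add_comm]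
  simp [diagSum]

end diagSum

/-! ### Partitions with bounded parts or a given number of parts -/

/-- The generating function of the partitions with all parts at most `k`. -/
noncomputable def boundedSeries (k : ℕ) : ℤ⟦X⟧ := partitionSeries fun s => ∀ x ∈ s, x ≤ k

/-- The generating function of all partitions. -/
noncomputable def allSeries : ℤ⟦X⟧ := partitionSeries fun _ => True

theorem boundedSeries_zero : boundedSeries 0 = 1 := by
  refine partitionSeries.eq_one fun s h0 => ⟨fun h => ?_, fun h => by simp [h]⟩
  refine Multiset.eq_zero_of_forall_notMem fun x hx => ?_
  have := h x hx
  simp_all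

/-- Either `k + 1` is not a part, or one copy of it can be removed. Used with `a = 0` and `a = 2`,
this replaces the product formulas for `1/(q)_k` by recursions free of division. -/
theorem partitionSeries.restrict_succ (a k : ℕ) (h : a ≤ k + 1) :
    partitionSeries (fun s => ∀ x ∈ s, a ≤ x ∧ x ≤ k + 1) =
      partitionSeries (fun s => ∀ x ∈ s, a ≤ x ∧ x ≤ k) +
        X ^ (k + 1) * partitionSeries (fun s => ∀ x ∈ s, a ≤ x ∧ x ≤ k + 1) := by
  rw [split _ (fun s => k + 1 ∉ s)]
  congr 1
  · apply congr
    intro s h0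
    constructor
    · rintro ⟨h1, h2⟩ x hx
      refine ⟨(h1 x hx).1, ?_⟩
      have := (h1 x hx).2
      rcases Nat.lt_or_ge x (k + 1) with h | h
      · omega
      · exact absurd ((le_antisymm this h) ▸ hx) h2
    · intro h1
      exact ⟨fun x hx => ⟨(h1 x hx).1, (h1 x hx).2.trans (Nat.le_succ k)⟩,
        fun h => by have := (h1 _ h).2; omega⟩
  · rw [← split]
    apply shift (k + 1) (fun s => (k + 1) ::ₘ s) (fun s => s.erase (k + 1))
    · intro s h0 hs
      refine ⟨by simp [h0], ⟨?_, by simp⟩, by simp [add_comm], by simp⟩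
      simpa [h] using hs
    · rintro s h0 ⟨hs, hk⟩
      rw [not_not] at hk
      refine ⟨fun h => h0 (Multiset.mem_of_mem_erase h),
        fun x hx => hs x (Multiset.mem_of_mem_erase hx), ?_, Multiset.cons_erase hk⟩
      conv_rhs => rw [← Multiset.cons_erase hk, Multiset.sum_cons]
      rw [add_comm]

theorem boundedSeries_succ (k : ℕ) :
    (1 - X ^ (k + 1)) * boundedSeries (k + 1) = boundedSeries k := by
  have := partitionSeries.restrict_succ 0 k (Nat.zero_le _)
  simp only [Nat.zero_le, true_and] at this
  rw [sub_mul, one_mul, sub_eq_iff_eq_add]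
  exact this

theorem one_sub_X_pow_mul_cancel {k : ℕ} {f g : ℤ⟦X⟧}
    (h : (1 - X ^ (k + 1)) * f = (1 - X ^ (k + 1)) * g) : f = g := by
  refine mul_left_cancel₀ (fun h0 => ?_) h
  have := congrArg (coeff 0) h0
  simp at this

theorem restrict_two_eq (k : ℕ) :
    partitionSeries (fun s => ∀ x ∈ s, 2 ≤ x ∧ x ≤ k + 1) = (1 - X) * boundedSeries (k + 1) := by
  induction k with
  | zero =>
    have := boundedSeries_succ 0
    rw [boundedSeries_zero] at this
    simp only [zero_add, pow_one] at this ⊢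
    rw [this]
    refine partitionSeries.eq_one fun s h0 => ⟨fun h => ?_, fun h => by simp [h]⟩
    refine Multiset.eq_zero_of_forall_notMem fun x hx => ?_
    have := h x hx
    omega
  | succ k ih =>
    refine one_sub_X_pow_mul_cancel (k := k + 1) ?_
    rw [mul_left_comm, boundedSeries_succ, ← ih, sub_mul, one_mul, sub_eq_iff_eq_add]
    exact partitionSeries.restrict_succ 2 (k + 1) (by omega)

theorem coeff_boundedSeries {n k : ℕ} (h : n ≤ k) :
    coeff n (boundedSeries k) = coeff n allSeries := by
  classical
  rw [boundedSeries, allSeries, partitionSeries.coeff_eq, partitionSeries.coeff_eq]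
  congr 2
  apply Finset.filter_congr
  intro s hs
  rw [mem_partitionFinset] at hs
  simp only [iff_true]
  intro x hx
  exact (Multiset.le_sum_of_mem hx).trans (by omega)

theorem series_card_succ (k e : ℕ) :
    partitionSeries (fun s => (∀ x ∈ s, ¬ x ≤ k + 1) ∧ s.card = e) =
      X ^ e * partitionSeries (fun s => (∀ x ∈ s, ¬ x ≤ k) ∧ s.card = e) := by
  apply partitionSeries.shift e (fun s => s.map Nat.succ) (fun s => s.map Nat.pred)
  · rintro s h0 ⟨hs, rfl⟩
    refine ⟨by simp, ⟨?_, by simp⟩, ?_, ?_⟩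
    · intro x hx
      obtain ⟨y, hy, rfl⟩ := Multiset.mem_map.1 hx
      have := hs y hy
      omega
    · simp [Nat.succ_eq_add_one, Multiset.sum_map_add]
    · simp [Multiset.map_map]
  · rintro s h0 ⟨hs, rfl⟩
    have h : (s.map Nat.pred).map Nat.succ = s := by
      rw [Multiset.map_map]
      conv_rhs => rw [← Multiset.map_id s]
      refine Multiset.map_congr rfl fun x hx => ?_
      have := hs x hx
      simp only [Function.comp, id, Nat.pred_eq_sub_one]
      omega
    refine ⟨?_, ⟨?_, by simp⟩, ?_, h⟩
    · intro hx
      obtain ⟨y, hy, h⟩ := Multiset.mem_map.1 hx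
      have := hs y hy
      rw [Nat.pred_eq_sub_one] at h
      omega
    · intro x hx
      obtain ⟨y, hy, rfl⟩ := Multiset.mem_map.1 hx
      have := hs y hy
      rw [Nat.pred_eq_sub_one]
      omega
    · conv_rhs => rw [← h]
      simp [Nat.succ_eq_add_one, Multiset.sum_map_add]

/-- Induction on `e` instead of conjugation: a partition into `e + 1` parts either contains a `1`,
which is removed, or has every part lowered by one. -/
theorem series_card_zero (e : ℕ) :
    partitionSeries (fun s => (∀ x ∈ s, ¬ x ≤ 0) ∧ s.card = e) = X ^ e * boundedSeries e := by
  induction e with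
  | zero =>
    rw [boundedSeries_zero, pow_zero, one_mul]
    exact partitionSeries.eq_one fun s h0 => ⟨fun h => by simpa using h.2, fun h => by simp [h]⟩
  | succ e ih =>
    refine one_sub_X_pow_mul_cancel (k := e) ?_
    rw [mul_left_comm, boundedSeries_succ, pow_succ', mul_assoc, ← ih, sub_mul, one_mul,
      ← pow_succ', ← series_card_succ, sub_eq_iff_eq_add, partitionSeries.split _ (fun s => 1 ∈ s)]
    congr 1
    · rw [← pow_one X]
      apply partitionSeries.shift 1 (fun s => 1 ::ₘ s) (fun s => s.erase 1)
      · rintro s h0 ⟨hs, hc⟩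
        refine ⟨by simp [h0], ⟨⟨?_, by simp [hc]⟩, by simp⟩, by simp [add_comm], by simp⟩
        simpa using hs
      · rintro s h0 ⟨⟨hs, hc⟩, h1⟩
        refine ⟨fun h => h0 (Multiset.mem_of_mem_erase h),
          ⟨fun x hx => hs x (Multiset.mem_of_mem_erase hx), ?_⟩, ?_, Multiset.cons_erase h1⟩
        · rw [Multiset.card_erase_of_mem h1, hc]; rfl
        · conv_rhs => rw [← Multiset.cons_erase h1, Multiset.sum_cons]
          rw [add_comm]
    · refine partitionSeries.congr fun s h0 => ⟨?_, ?_⟩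
      · rintro ⟨⟨h1, h2⟩, h3⟩
        refine ⟨fun x hx hx1 => ?_, h2⟩
        have := h1 x hx
        have : x = 1 := by omega
        exact h3 (this ▸ hx)
      · rintro ⟨h1, h2⟩
        exact ⟨⟨fun x hx hx1 => h1 x hx (by omega), h2⟩, fun h => h1 1 h (by omega)⟩

theorem series_card (k e : ℕ) :
    partitionSeries (fun s => (∀ x ∈ s, ¬ x ≤ k) ∧ s.card = e) =
      X ^ (e * (k + 1)) * boundedSeries e := by
  induction k with
  | zero => rw [series_card_zero]; ring
  | succ k ih => rw [series_card_succ, ih]; ring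

/-! ### Durfee rectangle identities -/

/-- `∑ q ^ (a (b + 1)) / ((q)_a (q)_b)` over `b = a + d`. -/
noncomputable def gapSeries (d : ℕ) : ℤ⟦X⟧ :=
  diagSum fun a => X ^ (a * (a + d) + a) * (boundedSeries a * boundedSeries (a + d))

theorem dvd_X_pow_mul {a k : ℕ} (h : a ≤ k) (f : ℤ⟦X⟧) : X ^ a ∣ X ^ k * f :=
  (pow_dvd_pow X h).mul_right f

theorem le_mul_add (a d : ℕ) : a ≤ a * (a + d) := by
  rcases a with _ | a
  · simp
  · exact Nat.le_mul_of_pos_right _ (by omega)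

/-- The Durfee rectangle series. -/
noncomputable def durfeeSeries (d : ℕ) : ℤ⟦X⟧ :=
  diagSum fun a => X ^ (a * (a + d)) * (boundedSeries a * boundedSeries (a + d))

/-- The difference carries a factor `1 - q^a`, which kills the term `a = 0` and turns `1/(q)_a` into
`1/(q)_(a-1)`; then `a` is shifted by one. -/
theorem durfeeSeries_sub_gapSeries (d : ℕ) :
    durfeeSeries d - gapSeries d =
      diagSum fun a => X ^ ((a + 1) * (a + d + 1)) * (boundedSeries a * boundedSeries (a + d + 1)) := by
  rw [durfeeSeries, gapSeries, ← diagSum.sub, diagSum.eq_head_add]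
  · rw [show X ^ (0 * (0 + d)) * (boundedSeries 0 * boundedSeries (0 + d)) -
        X ^ (0 * (0 + d) + 0) * (boundedSeries 0 * boundedSeries (0 + d)) = 0 by simp, zero_add]
    congr 1
    funext a
    rw [← boundedSeries_succ a, show a + 1 + d = a + d + 1 by ring]
    ring
  · exact fun a => dvd_sub (dvd_X_pow_mul (le_mul_add a d) _)
      (dvd_X_pow_mul (Nat.le_add_left _ _) _)

theorem durfeeSeries_sub_gapSeries_eq (d : ℕ) :
    durfeeSeries d - gapSeries d = X ^ (d + 1) * gapSeries (d + 1) := by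
  rw [durfeeSeries_sub_gapSeries, gapSeries,
    ← diagSum.const_mul _ fun a => dvd_X_pow_mul (Nat.le_add_left _ _) _]
  congr 1
  funext a
  rw [← add_assoc a d 1]
  ring

theorem durfeeSeries_succ (d : ℕ) : durfeeSeries (d + 1) = durfeeSeries d := by
  rw [← sub_add_cancel (durfeeSeries d) (gapSeries d), durfeeSeries_sub_gapSeries, gapSeries,
    ← diagSum.add, durfeeSeries]
  congr 1
  funext a
  rw [← boundedSeries_succ (a + d), ← add_assoc a d 1]
  ring

/-- The series does not depend on `d`, so `d` may be taken as large as desired; only the term `a =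
0` then contributes to a given coefficient. -/
theorem durfeeSeries_eq (d : ℕ) : durfeeSeries d = allSeries := by
  have h : ∀ k, durfeeSeries (d + k) = durfeeSeries d := by
    intro k
    induction k with
    | zero => rfl
    | succ k ih => rw [← add_assoc, durfeeSeries_succ, ih]
  ext n
  -- Raising `d` by `n + 1` makes every term with `a ≥ 1` divisible by `X ^ (n + 1)`.
  rw [← h (n + 1), durfeeSeries, diagSum, coeff_mk, Finset.sum_eq_single 0]
  · simp only [zero_mul, pow_zero, one_mul, boundedSeries_zero, zero_add]
    exact coeff_boundedSeries (by omega)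
  · intro a _ ha
    refine X_pow_dvd_iff.1 (dvd_X_pow_mul ?_ _) n (Nat.lt_succ_self n)
    calc n + 1 ≤ a + (d + (n + 1)) := by omega
      _ ≤ a * (a + (d + (n + 1))) := Nat.le_mul_of_pos_left _ (Nat.pos_of_ne_zero ha)
  · simp

theorem gapSeries_rec (d : ℕ) : gapSeries d = allSeries - X ^ (d + 1) * gapSeries (d + 1) := by
  rw [← durfeeSeries_sub_gapSeries_eq, durfeeSeries_eq, sub_sub_cancel]

/-! ### The crank generating function -/

/-- The generating function of the (normalised) crank `±d`. -/
noncomputable def crankSeries (d : ℕ) : ℤ⟦X⟧ :=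
  diagSum fun a => (1 - X) * (X ^ (a + (a + d) + a * (a + d)) *
    (boundedSeries a * boundedSeries (a + d)))

theorem crankSeries_eq (d : ℕ) :
    crankSeries d = X ^ d * gapSeries d - X ^ (d + 1) * gapSeries (d + 1) := by
  have hdvd : ∀ a, X ^ a ∣ X ^ (a + (a + d) + a * (a + d)) *
      (boundedSeries a * boundedSeries (a + d)) := fun a => dvd_X_pow_mul (by omega) _
  set S := diagSum fun a => X ^ (a + (a + d) + a * (a + d)) *
    (boundedSeries a * boundedSeries (a + d)) with hS
  have h1 : crankSeries d = (1 - X) * S := diagSum.const_mul _ hdvd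
  -- The right side is the Durfee sum weighted by `(1 - q^a)(1 - q^(a+d))`, expanded. These factors
  -- lower both denominators, and shifting `a` by one leaves `X * S`.
  have hX : X * S = durfeeSeries d - gapSeries d - X ^ d * gapSeries d + S := by
    rw [hS, ← diagSum.const_mul _ hdvd, durfeeSeries, gapSeries,
      ← diagSum.const_mul _ fun a => dvd_X_pow_mul (Nat.le_add_left _ _) _,
      ← diagSum.sub, ← diagSum.sub, ← diagSum.add]
    symm
    rw [diagSum.eq_head_add]
    · simp only [boundedSeries_zero, zero_mul, zero_add, pow_zero, add_zero, sub_self, zero_sub,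
        one_mul, neg_add_cancel]
      congr 1
      funext a
      rw [← boundedSeries_succ a, ← boundedSeries_succ (a + d), show a + 1 + d = a + d + 1 by ring]
      ring
    · intro a
      refine dvd_add (dvd_sub (dvd_sub (dvd_X_pow_mul (le_mul_add a d) _)
        (dvd_X_pow_mul (Nat.le_add_left _ _) _)) ?_) (hdvd a)
      exact (dvd_X_pow_mul (Nat.le_add_left _ _) _).mul_left _
  rw [← durfeeSeries_sub_gapSeries_eq, h1, sub_mul, one_mul, hX]
  ring

/-- Partitions with exactly `k` ones and exactly `e` parts larger than `k`. -/
theorem series_ones_large (k e : ℕ) :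
    partitionSeries (fun s => s.count 1 = k + 1 ∧ (s.filter fun x => k + 1 < x).card = e) =
      (1 - X) * (X ^ (k + 1 + e + (k + 1) * e) * (boundedSeries (k + 1) * boundedSeries e)) := by
  have hA : partitionSeries (fun s => (∀ x ∈ s, x ≤ k + 1) ∧ s.count 1 = k + 1) =
      X ^ (k + 1) * ((1 - X) * boundedSeries (k + 1)) := by
    rw [← restrict_two_eq]
    apply partitionSeries.shift (k + 1) (fun s => s + Multiset.replicate (k + 1) 1)
      (fun s => s.filter (· ≠ 1))
    · intro s h0 hs
      have h1 : 1 ∉ s := fun h => by have := (hs 1 h).1; omega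
      refine ⟨?_, ⟨?_, ?_⟩, ?_, ?_⟩
      · simp [h0, Multiset.mem_replicate]
      · intro x hx
        rcases Multiset.mem_add.1 hx with hx | hx
        · exact (hs x hx).2
        · rw [Multiset.eq_of_mem_replicate hx]; omega
      · simp [Multiset.count_eq_zero.2 h1]
      · simp only [Multiset.sum_add, Multiset.sum_replicate, smul_eq_mul, mul_one]
      · rw [Multiset.filter_add, Multiset.filter_eq_self.2, Multiset.filter_eq_nil.2, add_zero]
        · intro x hx
          simp [Multiset.eq_of_mem_replicate hx]
        · rintro x hx rfl
          exact h1 hx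
    · rintro s h0 ⟨hs, h1⟩
      have h2 : s.filter (· ≠ 1) + Multiset.replicate (k + 1) 1 = s := by
        rw [← h1, ← Multiset.filter_eq', add_comm]
        exact Multiset.filter_add_not (· = 1) s
      refine ⟨fun h => h0 (Multiset.mem_of_mem_filter h), ?_, ?_, h2⟩
      · intro x hx
        rw [Multiset.mem_filter] at hx
        have := hs x hx.1
        have : x ≠ 0 := fun h => h0 (h ▸ hx.1)
        omega
      · conv_rhs => rw [← h2]
        simp only [Multiset.sum_add, Multiset.sum_replicate, smul_eq_mul, mul_one]
  -- The parts at most `k + 1`, including all the ones, are independent of the `e` larger parts.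
  have hmul := partitionSeries.mul (fun x => x ≤ k + 1) (fun s => s.count 1 = k + 1)
    (fun s => s.card = e)
  rw [hA, series_card] at hmul
  rw [partitionSeries.congr fun s h0 => ?_, hmul]
  · ring
  · rw [Multiset.count_filter_of_pos (by omega)]
    simp only [not_le]

/-- Partitions without ones, by largest part; the extra terms are the normalisation at `n = 1`. -/
theorem series_no_ones (e : ℕ) :
    partitionSeries (fun s => 1 ∉ s ∧ s.sup = e) +
        ((if e = 1 then X else 0) - (if e = 0 then X else 0)) =
      (1 - X) * (X ^ e * boundedSeries e) := by
  rcases e with _ | _ | m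
  · rw [partitionSeries.eq_one, boundedSeries_zero]
    · simp [sub_eq_add_neg]
    · intro s h0
      refine ⟨fun h => Multiset.eq_zero_of_forall_notMem fun x hx => ?_, fun h => by simp [h]⟩
      have := Multiset.le_sup hx
      rw [h.2] at this
      simp_all
  · rw [partitionSeries.eq_zero]
    · have := boundedSeries_succ 0
      rw [boundedSeries_zero] at this
      simp only [zero_add, pow_one] at this ⊢
      rw [mul_left_comm, this]
      simp
    · rintro s h0 ⟨h1, h2⟩
      have h : s = 0 := by
        refine Multiset.eq_zero_of_forall_notMem fun x hx => ?_
        have := Multiset.le_sup hx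
        rw [h2] at this
        interval_cases x <;> contradiction
      simp [h] at h2
  · simp only [show m + 1 + 1 ≠ 1 by omega, show m + 1 + 1 ≠ 0 by omega, if_false, sub_zero, add_zero]
    rw [mul_left_comm, ← restrict_two_eq]
    apply partitionSeries.shift (m + 1 + 1) (fun s => (m + 1 + 1) ::ₘ s)
      (fun s => s.erase (m + 1 + 1))
    · intro s h0 hs
      refine ⟨by simp [h0], ⟨?_, ?_⟩, by simp [add_comm], by simp⟩
      · rw [Multiset.mem_cons, not_or]
        exact ⟨by omega, fun h => by have := (hs 1 h).1; omega⟩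
      · rw [Multiset.sup_cons]
        exact sup_eq_left.2 (Multiset.sup_le.2 fun x hx => (hs x hx).2)
    · rintro s h0 ⟨hs, hk⟩
      have hmem : m + 1 + 1 ∈ s := by
        by_contra hmem
        have : s.sup ≤ m + 1 := Multiset.sup_le.2 fun x hx => by
          have h1 := Multiset.le_sup hx
          have : x ≠ m + 1 + 1 := fun h => hmem (h ▸ hx)
          omega
        omega
      refine ⟨fun h => h0 (Multiset.mem_of_mem_erase h),
        fun x hx => ?_, ?_, Multiset.cons_erase hmem⟩
      · have hx := Multiset.mem_of_mem_erase hx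
        have := Multiset.le_sup hx
        have : x ≠ 0 := fun h => h0 (h ▸ hx)
        have : x ≠ 1 := fun h => hs (h ▸ hx)
        omega
      · conv_rhs => rw [← Multiset.cons_erase hmem, Multiset.sum_cons]
        rw [add_comm]

/-- The crank of a multiset of positive integers. -/
def multisetCrank (s : Multiset ℕ) : ℤ :=
  if 1 ∈ s then ((s.filter (fun i => s.count 1 < i)).card : ℤ) - (s.count 1 : ℤ) else (s.sup : ℤ)

theorem partitionFinset_one : partitionFinset 1 = {{1}} := by
  rw [partitionFinset, Finset.univ_unique, Finset.image_singleton]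
  rfl

/-- The partition `1` has literal crank `-1`, so the convention at `n = 1` differs from the literal
count only by `+1` at `m = 1` and `-1` at `m = 0`. -/
theorem crankCount_eq (m : ℤ) (n : ℕ) :
    crankCount m n = coeff n (partitionSeries fun s => multisetCrank s = m) +
      ((if m = 1 then coeff n (X : ℤ⟦X⟧) else 0) - (if m = 0 then coeff n (X : ℤ⟦X⟧) else 0)) := by
  have key : ((Finset.univ.filter (fun p : n.Partition => p.crank = m)).card : ℤ) =
      coeff n (partitionSeries fun s => multisetCrank s = m) :=
    card_filter_partition (n := n) fun s => multisetCrank s = m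
  rw [crankCount, coeff_X]
  split_ifs with hn h0 h1 h1 h2 h3
  all_goals try omega
  all_goals try simp only [add_zero, sub_zero, zero_sub, sub_self]
  all_goals subst hn
  all_goals
    classical
    rw [partitionSeries.coeff_eq, partitionFinset_one, Finset.filter_singleton]
    simp [multisetCrank, Multiset.filter_singleton]
  all_goals first | omega | (split_ifs <;> first | rfl | (exfalso; omega))

theorem partitionSeries_eq_diagSum (Q : Multiset ℕ → Prop) (c : Multiset ℕ → ℕ)
    (hc : ∀ s, 0 ∉ s → c s ≤ s.sum) :
    partitionSeries Q = diagSum fun a => partitionSeries fun s => Q s ∧ c s = a := by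
  classical
  ext n
  rw [diagSum, coeff_mk, partitionSeries.coeff_eq]
  simp only [partitionSeries.coeff_eq]
  rw [Finset.card_eq_sum_card_fiberwise (f := c) (t := Finset.range (n + 1))]
  · push_cast
    simp only [Finset.filter_filter]
  · intro s hs
    simp only [Finset.coe_filter, mem_partitionFinset, Set.mem_ofPred_eq] at hs
    have := hc s hs.1.1
    simp only [Finset.coe_range, Set.mem_Iio]
    omega

theorem card_le_sum {s : Multiset ℕ} (h0 : 0 ∉ s) : s.card ≤ s.sum := by
  have := Multiset.card_nsmul_le_sum (s := s) (a := 1) fun x hx =>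
    Nat.pos_of_ne_zero fun h => h0 (h ▸ hx)
  simpa using this

/-- The index `a` of `crankSeries` is the number of ones. For `a ≥ 1` there are `a + d` parts larger
than `a`; the term `a = 0` counts partitions without ones and absorbs the correction at `n = 1`. -/
theorem crankCount_natCast (d n : ℕ) : crankCount (d : ℤ) n = coeff n (crankSeries d) := by
  rw [crankCount_eq, partitionSeries_eq_diagSum _ (fun s => s.count 1)
    fun s h0 => (Multiset.count_le_card _ _).trans (card_le_sum h0), crankSeries,
    diagSum, diagSum, coeff_mk, coeff_mk, Finset.sum_range_succ', Finset.sum_range_succ',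
    add_assoc]
  congr 1
  · refine Finset.sum_congr rfl fun a _ => ?_
    rw [← series_ones_large, partitionSeries.congr]
    intro s h0
    constructor
    · rintro ⟨h1, h2⟩
      have : 1 ∈ s := Multiset.count_pos.1 (by omega)
      rw [multisetCrank, if_pos this, h2] at h1
      exact ⟨h2, by omega⟩
    · rintro ⟨h1, h2⟩
      have : 1 ∈ s := Multiset.count_pos.1 (by omega)
      rw [multisetCrank, if_pos this, h1, h2]
      exact ⟨by push_cast; ring, rfl⟩
  · have h := congrArg (coeff n) (series_no_ones d)
    simp only [zero_add, zero_mul, add_zero, boundedSeries_zero, one_mul]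
    rw [← h, map_add, map_sub, partitionSeries.congr]
    · simp only [apply_ite (coeff n), map_zero]
      norm_cast
    · intro s h0
      rw [Multiset.count_eq_zero]
      constructor
      · rintro ⟨h1, h2⟩
        rw [multisetCrank, if_neg h2] at h1
        exact ⟨h2, by exact_mod_cast h1⟩
      · rintro ⟨h1, h2⟩
        rw [multisetCrank, if_neg h1, h2]
        exact ⟨rfl, h1⟩

/-- Here the index `a` is the number of parts exceeding the number of ones, which is `a + d`. The
summand of `crankSeries` is symmetric in `a` and `a + d`, so the same series results. For `d > 0`
partitions without ones do not occur, their crank being nonnegative. -/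
theorem crankCount_neg (d n : ℕ) : crankCount (-(d : ℤ)) n = coeff n (crankSeries d) := by
  rcases d with _ | d
  · simpa using crankCount_natCast 0 n
  rw [crankCount_eq, partitionSeries_eq_diagSum _
    (fun s => (s.filter fun i => s.count 1 < i).card)
    fun s h0 => (Multiset.card_le_card (Multiset.filter_le _ _)).trans (card_le_sum h0),
    if_neg (by omega), if_neg (by omega), sub_zero, add_zero, crankSeries]
  congr 2
  funext a
  rw [← add_assoc a d 1, mul_comm (boundedSeries a), add_comm a (a + d + 1), mul_comm a,
    ← series_ones_large, partitionSeries.congr]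
  intro s h0
  constructor
  · rintro ⟨h1, h2⟩
    by_cases h : 1 ∈ s
    · rw [multisetCrank, if_pos h, h2] at h1
      have : s.count 1 = a + d + 1 := by omega
      rw [this] at h2
      exact ⟨this, h2⟩
    · rw [multisetCrank, if_neg h] at h1
      omega
  · rintro ⟨h1, h2⟩
    have : 1 ∈ s := Multiset.count_pos.1 (by omega)
    rw [multisetCrank, if_pos this, h1, h2]
    exact ⟨by push_cast; ring, rfl⟩

/-! ### The rank and the column-to-row bijection -/

/-- The rank of a multiset of positive integers. -/
def multisetRank (s : Multiset ℕ) : ℤ := (s.sup : ℤ) - s.card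

theorem sup_mem {s : Multiset ℕ} (h : s ≠ 0) : s.sup ∈ s := by
  induction s using Multiset.induction with
  | empty => exact absurd rfl h
  | cons a t ih =>
    rw [Multiset.sup_cons]
    rcases le_total a t.sup with h1 | h1
    · rw [sup_eq_right.2 h1]
      by_cases ht : t = 0
      · subst ht
        simp_all
      · exact Multiset.mem_cons_of_mem (ih ht)
    · rw [sup_eq_left.2 h1]
      exact Multiset.mem_cons_self a t

theorem sum_map_pred_add_card {s : Multiset ℕ} (h0 : 0 ∉ s) :
    (s.map Nat.pred).sum + s.card = s.sum := by
  induction s using Multiset.induction with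
  | empty => simp
  | cons a t ih =>
    rw [Multiset.mem_cons, not_or] at h0
    have := ih h0.2
    have := h0.1
    rw [Multiset.map_cons, Multiset.sum_cons, Multiset.card_cons, Multiset.sum_cons,
      Nat.pred_eq_sub_one]
    omega

theorem map_succ_map_pred {s : Multiset ℕ} (h0 : 0 ∉ s) :
    (s.map Nat.pred).map Nat.succ = s := by
  rw [Multiset.map_map]
  conv_rhs => rw [← Multiset.map_id s]
  refine Multiset.map_congr rfl fun x hx => ?_
  have : x ≠ 0 := fun h => h0 (h ▸ hx)
  simp only [Function.comp, id, Nat.pred_eq_sub_one]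
  omega

theorem filter_ne_zero_add (s : Multiset ℕ) :
    s.filter (· ≠ 0) + Multiset.replicate (s.count 0) 0 = s := by
  rw [← Multiset.filter_eq', add_comm]
  exact Multiset.filter_add_not (· = 0) s

theorem sum_filter_ne_zero (s : Multiset ℕ) : (s.filter (· ≠ 0)).sum = s.sum := by
  conv_rhs => rw [← filter_ne_zero_add s]
  simp only [Multiset.sum_add, Multiset.sum_replicate, smul_eq_mul, mul_zero, add_zero]

theorem sup_filter_ne_zero (s : Multiset ℕ) : (s.filter (· ≠ 0)).sup = s.sup := by
  apply le_antisymm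
  · exact Multiset.sup_mono (Multiset.subset_of_le (Multiset.filter_le _ _))
  · refine Multiset.sup_le.2 fun x hx => ?_
    rcases Nat.eq_zero_or_pos x with rfl | h
    · exact Nat.zero_le _
    · exact Multiset.le_sup (Multiset.mem_filter.2 ⟨hx, h.ne'⟩)

/-- Remove the first column and add a row `c` cells longer than it. -/
def columnToRow (c : ℤ) (s : Multiset ℕ) : Multiset ℕ :=
  (((s.card : ℤ) + c).toNat ::ₘ s.map Nat.pred).filter (· ≠ 0)

/-- Remove the largest part and add a column `c` cells shorter than it. -/
def rowToColumn (c : ℤ) (s : Multiset ℕ) : Multiset ℕ :=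
  (s.erase s.sup).map Nat.succ +
    Multiset.replicate (((s.sup : ℤ) - c).toNat - (s.erase s.sup).card) 1

theorem columnToRow_spec {c : ℤ} {s : Multiset ℕ} (h0 : 0 ∉ s) (hr : multisetRank s ≤ c + 1)
    (hc : 0 ≤ (s.sum : ℤ) + c) :
    0 ∉ columnToRow c s ∧ c - 1 ≤ multisetRank (columnToRow c s) ∧
      ((columnToRow c s).sum : ℤ) = s.sum + c ∧ rowToColumn c (columnToRow c s) = s := by
  rw [multisetRank] at hr
  have hM : 0 ≤ (s.card : ℤ) + c := by
    by_cases hs : s = 0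
    · subst hs; simpa using hc
    · have : s.sup ≠ 0 := fun h => h0 (h ▸ sup_mem hs)
      omega
  obtain ⟨M, hMe⟩ := Int.eq_ofNat_of_zero_le hM
  have hle : ∀ x ∈ s.map Nat.pred, x ≤ M := by
    intro x hx
    obtain ⟨y, hy, rfl⟩ := Multiset.mem_map.1 hx
    have := Multiset.le_sup hy
    rw [Nat.pred_eq_sub_one]
    omega
  have hsup : (columnToRow c s).sup = M := by
    rw [columnToRow, sup_filter_ne_zero, hMe, Int.toNat_natCast, Multiset.sup_cons]
    exact sup_eq_left.2 (Multiset.sup_le.2 hle)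
  refine ⟨fun h => (Multiset.mem_filter.1 h).2 rfl, ?_, ?_, ?_⟩
  · rw [multisetRank, hsup]
    have : (columnToRow c s).card ≤ s.card + 1 := by
      refine (Multiset.card_le_card (Multiset.filter_le _ _)).trans ?_
      simp
    omega
  · rw [columnToRow, sum_filter_ne_zero, hMe, Int.toNat_natCast, Multiset.sum_cons]
    have := sum_map_pred_add_card h0
    omega
  · rw [rowToColumn, hsup]
    have herase : (columnToRow c s).erase M = (s.map Nat.pred).filter (· ≠ 0) := by
      rw [columnToRow, hMe, Int.toNat_natCast]
      rcases Nat.eq_zero_or_pos M with rfl | hpos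
      · rw [Multiset.filter_cons_of_neg _ (by simp), Multiset.erase_of_notMem]
        exact fun h => (Multiset.mem_filter.1 h).2 rfl
      · rw [Multiset.filter_cons_of_pos (p := (· ≠ 0)) _ hpos.ne', Multiset.erase_cons_head]
    have hcard := congrArg Multiset.card (filter_ne_zero_add (s.map Nat.pred))
    rw [Multiset.card_add, Multiset.card_replicate, Multiset.card_map] at hcard
    -- The column to restore has `s.card` cells; those not beside a surviving row are exactly the
    -- ones of `s`, which became zeros and were filtered out.
    rw [herase, show ((M : ℤ) - c).toNat - ((s.map Nat.pred).filter (· ≠ 0)).card =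
      (s.map Nat.pred).count 0 by omega, ← Multiset.map_replicate Nat.succ _ 0, ← Multiset.map_add,
      filter_ne_zero_add, map_succ_map_pred h0]

theorem rowToColumn_spec {c : ℤ} {s : Multiset ℕ} (h0 : 0 ∉ s) (hr : c - 1 ≤ multisetRank s)
    (hc : c ≤ s.sum) :
    0 ∉ rowToColumn c s ∧ multisetRank (rowToColumn c s) ≤ c + 1 ∧
      ((rowToColumn c s).sum : ℤ) + c = s.sum ∧ columnToRow c (rowToColumn c s) = s := by
  rw [multisetRank] at hr
  have hcons : s ≠ 0 → s.sup ::ₘ s.erase s.sup = s := fun h => Multiset.cons_erase (sup_mem h)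
  have hcard : ((s.erase s.sup).card : ℤ) ≤ s.sup - c := by
    by_cases hs : s = 0
    · subst hs; simpa using hc
    · have := congrArg Multiset.card (hcons hs)
      rw [Multiset.card_cons] at this
      omega
  have hsum : s.sup + (s.erase s.sup).sum = s.sum := by
    by_cases hs : s = 0
    · subst hs; simp
    · conv_rhs => rw [← hcons hs, Multiset.sum_cons]
  have hcard' : (rowToColumn c s).card = ((s.sup : ℤ) - c).toNat := by
    rw [rowToColumn, Multiset.card_add, Multiset.card_map, Multiset.card_replicate]
    omega
  refine ⟨?_, ?_, ?_, ?_⟩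
  · simp [rowToColumn, Multiset.mem_replicate]
  · have : (rowToColumn c s).sup ≤ s.sup + 1 := by
      refine Multiset.sup_le.2 fun x hx => ?_
      rcases Multiset.mem_add.1 hx with hx | hx
      · obtain ⟨y, hy, rfl⟩ := Multiset.mem_map.1 hx
        exact Nat.succ_le_succ (Multiset.le_sup (Multiset.mem_of_mem_erase hy))
      · rw [Multiset.eq_of_mem_replicate hx]; omega
    rw [multisetRank, hcard']
    omega
  · have : (rowToColumn c s).sum = (s.erase s.sup).sum + ((s.sup : ℤ) - c).toNat := by
      rw [← hcard']
      simp only [rowToColumn, Multiset.sum_add, Multiset.card_add, Multiset.card_map,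
        Multiset.card_replicate, Multiset.sum_replicate, Nat.succ_eq_add_one, Multiset.sum_map_add,
        Multiset.map_id', Multiset.map_const', smul_eq_mul, mul_one]
      ring
    omega
  · rw [columnToRow, hcard', show ((((s.sup : ℤ) - c).toNat : ℤ) + c).toNat = s.sup by omega,
      rowToColumn, Multiset.map_add, Multiset.map_map, Multiset.map_replicate]
    have : (s.erase s.sup).map (Nat.pred ∘ Nat.succ) = s.erase s.sup := by
      simp
    have hz : ∀ k, (Multiset.replicate k (Nat.pred 1)).filter (· ≠ 0) = 0 := fun k =>
      Multiset.filter_eq_nil.2 fun x hx => by simp [Multiset.eq_of_mem_replicate hx]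
    rw [this, ← Multiset.cons_add, Multiset.filter_add, hz, add_zero]
    by_cases hs : s = 0
    · subst hs; simp
    · rw [hcons hs, Multiset.filter_eq_self]
      exact fun x hx h => h0 (h ▸ hx)

theorem multisetRank_lt_sum {s : Multiset ℕ} (hs : s ≠ 0) : multisetRank s < s.sum := by
  have h1 := Multiset.le_sum_of_mem (sup_mem hs)
  have h2 := Multiset.card_pos.2 hs
  rw [multisetRank]
  omega

theorem neg_sum_lt_multisetRank {s : Multiset ℕ} (h0 : 0 ∉ s) (hs : s ≠ 0) :
    -(s.sum : ℤ) < multisetRank s := by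
  have h1 := sum_map_pred_add_card h0
  have h2 : s.sup ≠ 0 := fun h => h0 (h ▸ sup_mem hs)
  rw [multisetRank]
  omega

/-- The value `c = 1` fails because the empty partition has rank `0 ≥ c - 1` but size less than `c`.
-/
theorem rank_shift {c : ℕ} (hc : c ≠ 1) :
    partitionSeries (fun s => (c : ℤ) - 1 ≤ multisetRank s) =
      X ^ c * partitionSeries (fun s => multisetRank s ≤ (c : ℤ) + 1) := by
  apply partitionSeries.shift c (columnToRow c) (rowToColumn c)
  · intro s h0 hs
    obtain ⟨h1, h2, h3, h4⟩ := columnToRow_spec h0 hs (by positivity)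
    exact ⟨h1, h2, by exact_mod_cast h3, h4⟩
  · intro s h0 hs
    have hle : (c : ℤ) ≤ s.sum := by
      by_cases h : s = 0
      · subst h
        simp [multisetRank] at hs ⊢
        omega
      · have := multisetRank_lt_sum h
        omega
    obtain ⟨h1, h2, h3, h4⟩ := rowToColumn_spec h0 hs hle
    exact ⟨h1, h2, by exact_mod_cast h3, h4⟩

/-- The same bijection at `-c`, read backwards; this makes the conjugation symmetry of the rank
unnecessary. -/
theorem rank_shift_neg {c : ℕ} (hc : c ≠ 1) :
    partitionSeries (fun s => multisetRank s ≤ 1 - (c : ℤ)) =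
      X ^ c * partitionSeries (fun s => -(c : ℤ) - 1 ≤ multisetRank s) := by
  apply partitionSeries.shift c (rowToColumn (-c)) (columnToRow (-c))
  · intro s h0 hs
    obtain ⟨h1, h2, h3, h4⟩ := rowToColumn_spec h0 hs (by omega)
    exact ⟨h1, by omega, by omega, h4⟩
  · intro s h0 hs
    have hle : 0 ≤ (s.sum : ℤ) + -c := by
      by_cases h : s = 0
      · subst h
        simp [multisetRank] at hs ⊢
        omega
      · have := neg_sum_lt_multisetRank h0 h
        omega
    obtain ⟨h1, h2, h3, h4⟩ := columnToRow_spec h0 (by omega) hle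
    exact ⟨h1, h2, by omega, h4⟩

/-! ### Parts divisible by three and the convolution with `p₃` -/

/-- The generating function of the partitions without parts divisible by three. -/
noncomputable def threeRegularSeries : ℤ⟦X⟧ := partitionSeries fun s => ∀ x ∈ s, ¬ 3 ∣ x

theorem pThree_eq (n : ℕ) : (pThree n : ℤ) = coeff n threeRegularSeries := by
  rw [pThree, Nat.Partition.restricted,
    card_filter_partition fun s => ∀ i ∈ s, (i : ℤ) ≡ 1 [ZMOD 3] ∨ (i : ℤ) ≡ -1 [ZMOD 3],
    threeRegularSeries, partitionSeries.congr]
  intro s _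
  refine forall₂_congr fun x _ => ?_
  simp only [Int.ModEq]
  omega

theorem series_three_dvd :
    partitionSeries (fun s => ∀ x ∈ s, 3 ∣ x) = expand 3 three_ne_zero allSeries := by
  classical
  ext n
  rw [coeff_expand, allSeries, partitionSeries.coeff_eq]
  have hmul : ∀ s : Multiset ℕ, (∀ x ∈ s, 3 ∣ x) → (s.map (· / 3)).map (3 * ·) = s := by
    intro s hs
    rw [Multiset.map_map]
    conv_rhs => rw [← Multiset.map_id s]
    exact Multiset.map_congr rfl fun x hx => Nat.mul_div_cancel' (hs x hx)
  split_ifs with h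
  · obtain ⟨k, rfl⟩ := h
    rw [Nat.mul_div_cancel_left _ three_pos, partitionSeries.coeff_eq, Finset.filter_true]
    norm_cast
    refine Finset.card_nbij' (Multiset.map (· / 3)) (Multiset.map (3 * ·)) ?_ ?_ ?_ ?_ <;>
      simp only [Set.MapsTo, Set.LeftInvOn, Set.RightInvOn, Finset.mem_coe, Finset.mem_filter,
        mem_partitionFinset, and_imp]
    · intro s h0 hs h3
      rw [← hmul s h3, Multiset.sum_map_mul_left, Multiset.map_id'] at hs
      refine ⟨fun hx => ?_, by omega⟩
      obtain ⟨y, hy, h⟩ := Multiset.mem_map.1 hx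
      have := h3 y hy
      have : y ≠ 0 := fun h => h0 (h ▸ hy)
      omega
    · intro s h0 hs
      refine ⟨⟨?_, ?_⟩, ?_⟩
      · simpa using h0
      · rw [Multiset.sum_map_mul_left, Multiset.map_id', hs]
      · intro x hx
        obtain ⟨y, hy, rfl⟩ := Multiset.mem_map.1 hx
        exact Nat.dvd_mul_right 3 y
    · exact fun s _ _ h3 => hmul s h3
    · intro s _ _
      simp
  · norm_cast
    rw [Finset.card_eq_zero, Finset.filter_eq_empty_iff]
    intro s hs h3
    exact h ((mem_partitionFinset.1 hs).2 ▸ Multiset.dvd_sum h3)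

theorem allSeries_eq_mul :
    threeRegularSeries * expand 3 three_ne_zero allSeries = allSeries := by
  have := partitionSeries.mul (fun x => 3 ∣ x) (fun _ => True) (fun _ => True)
  simp only [and_true] at this
  rw [mul_comm, ← series_three_dvd, threeRegularSeries, ← this, allSeries]

theorem sum_crankCount_mul_pThree {m : ℤ} {f : ℤ⟦X⟧} (hf : ∀ n, crankCount m n = coeff n f)
    (n : ℕ) :
    ∑ k ∈ Finset.range (n + 1) with 3 * k ≤ n, crankCount m k * (pThree (n - 3 * k) : ℤ) =
      coeff n (threeRegularSeries * expand 3 three_ne_zero f) := by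
  rw [mul_comm, coeff_mul, Finset.Nat.sum_antidiagonal_eq_sum_range_succ
    fun i j => coeff i (expand 3 three_ne_zero f) * coeff j threeRegularSeries]
  simp only [coeff_expand, ite_mul, zero_mul, hf, pThree_eq]
  rw [← Finset.sum_filter]
  refine Finset.sum_nbij' (3 * ·) (· / 3) ?_ ?_ ?_ ?_ ?_
  · intro k hk
    simp only [Finset.mem_filter, Finset.mem_range] at hk ⊢
    exact ⟨by omega, Nat.dvd_mul_right 3 k⟩
  · intro k hk
    simp only [Finset.mem_filter, Finset.mem_range] at hk ⊢
    omega
  · intro k hk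
    simp
  · intro k hk
    exact Nat.mul_div_cancel' (Finset.mem_filter.1 hk).2
  · intro k hk
    simp

/-! ### The common recurrence and the conclusion -/

theorem eq_of_recurrence {A B : ℕ → ℤ⟦X⟧} {P : ℤ⟦X⟧}
    (hA : ∀ m, A m = X ^ (3 * m) * (P - A (m + 1)))
    (hB : ∀ m, B m = X ^ (3 * m) * (P - B (m + 1))) (m : ℕ) : A m = B m := by
  -- The difference at `m` is `-X ^ (3 * m)` times the difference at `m + 1`, a gain of a factor `X`
  -- only when `m > 0`; the case `m = 0` is read off from `m = 1` at the end.
  have key : ∀ n m, 0 < m → X ^ n ∣ A m - B m := by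
    intro n
    induction n with
    | zero => simp
    | succ n ih =>
      intro m hm
      rw [hA, hB, ← mul_sub, sub_sub_sub_cancel_left, ← neg_sub, pow_succ']
      exact mul_dvd_mul (dvd_pow_self X (by omega)) ((dvd_neg).2 (ih _ (Nat.succ_pos m)))
  have hpos : ∀ m, 0 < m → A m = B m := by
    intro m hm
    rw [← sub_eq_zero]
    ext n
    rw [map_zero]
    exact X_pow_dvd_iff.1 (key (n + 1) m hm) n (Nat.lt_succ_self n)
  rw [hA, hB, hpos _ (Nat.succ_pos m)]

/-- The generating function of the partitions with rank at least `3 m - 1`. -/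
noncomputable def rankTailSeries (m : ℕ) : ℤ⟦X⟧ :=
  partitionSeries fun s => ((3 * m : ℕ) : ℤ) - 1 ≤ multisetRank s

/-- The generating function of the partitions with rank at most `1 - 3 m`. -/
noncomputable def rankLowerTailSeries (m : ℕ) : ℤ⟦X⟧ :=
  partitionSeries fun s => multisetRank s ≤ 1 - ((3 * m : ℕ) : ℤ)

theorem allSeries_sub (Q R : Multiset ℕ → Prop) (h : ∀ s, ¬ Q s ↔ R s) :
    partitionSeries R = allSeries - partitionSeries Q := by
  rw [allSeries, partitionSeries.split (fun _ => True) Q]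
  simp only [true_and, h]
  exact (add_sub_cancel_left _ _).symm

/-- The complement of rank at most `3m + 1` is rank at least `3(m + 1) - 1`: the step of three makes
the recurrence close up. -/
theorem rankTailSeries_rec (m : ℕ) :
    rankTailSeries m = X ^ (3 * m) * (allSeries - rankTailSeries (m + 1)) := by
  rw [rankTailSeries, rank_shift (by omega), rankTailSeries, allSeries_sub]
  intro s
  push_cast
  omega

theorem rankLowerTailSeries_rec (m : ℕ) :
    rankLowerTailSeries m = X ^ (3 * m) * (allSeries - rankLowerTailSeries (m + 1)) := by
  rw [rankLowerTailSeries, rank_shift_neg (by omega), rankLowerTailSeries, allSeries_sub]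
  intro s
  push_cast
  omega

theorem rankTailSeries_eq (m : ℕ) :
    rankTailSeries m = threeRegularSeries * expand 3 three_ne_zero (X ^ m * gapSeries m) := by
  refine eq_of_recurrence (P := allSeries)
    (B := fun m => threeRegularSeries * expand 3 three_ne_zero (X ^ m * gapSeries m))
    rankTailSeries_rec (fun m => ?_) m
  -- With `P` factored as `R(q) P(q^3)`, the recurrence is that of `gapSeries` at `q^3`, multiplied
  -- by `R`.
  conv_rhs => rw [← allSeries_eq_mul, ← mul_sub, ← map_sub, ← gapSeries_rec]
  rw [map_mul, map_pow, expand_X, ← pow_mul]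
  ring

theorem rankLowerTailSeries_eq (m : ℕ) : rankLowerTailSeries m = rankTailSeries m :=
  eq_of_recurrence rankLowerTailSeries_rec rankTailSeries_rec m

theorem rankCount_eq (r : ℤ) (n : ℕ) :
    (rankCount r n : ℤ) = coeff n (partitionSeries fun s => multisetRank s = r) :=
  card_filter_partition fun s => multisetRank s = r

theorem series_three_ranks (a : ℤ) :
    partitionSeries (fun s => a ≤ multisetRank s ∧ multisetRank s ≤ a + 2) =
      partitionSeries (fun s => multisetRank s = a) +
        partitionSeries (fun s => multisetRank s = a + 1) +
        partitionSeries (fun s => multisetRank s = a + 2) := by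
  rw [partitionSeries.split _ fun s => multisetRank s ≤ a + 1,
    partitionSeries.split (fun s => (a ≤ multisetRank s ∧ multisetRank s ≤ a + 2) ∧
      multisetRank s ≤ a + 1) fun s => multisetRank s = a]
  refine congrArg₂ _ (congrArg₂ _ ?_ ?_) ?_ <;>
    exact partitionSeries.congr fun s _ => by omega

theorem rankTailSeries_sub (m : ℕ) :
    rankTailSeries m - rankTailSeries (m + 1) =
      partitionSeries fun s => (3 * m : ℤ) - 1 ≤ multisetRank s ∧ multisetRank s ≤ 3 * m - 1 + 2 := by
  rw [sub_eq_iff_eq_add, rankTailSeries,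
    partitionSeries.split _ fun s => multisetRank s ≤ 3 * m - 1 + 2, rankTailSeries]
  refine congrArg₂ _ ?_ ?_ <;> exact partitionSeries.congr fun s _ => by push_cast; omega

theorem rankLowerTailSeries_sub (m : ℕ) :
    rankLowerTailSeries m - rankLowerTailSeries (m + 1) =
      partitionSeries fun s =>
        (3 * -m : ℤ) - 1 ≤ multisetRank s ∧ multisetRank s ≤ 3 * -m - 1 + 2 := by
  rw [sub_eq_iff_eq_add, rankLowerTailSeries,
    partitionSeries.split _ fun s => (3 * -m : ℤ) - 1 ≤ multisetRank s, rankLowerTailSeries]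
  refine congrArg₂ _ ?_ ?_ <;> exact partitionSeries.congr fun s _ => by push_cast; omega

theorem rankTailSeries_sub_eq (m : ℕ) :
    rankTailSeries m - rankTailSeries (m + 1) =
      threeRegularSeries * expand 3 three_ne_zero (crankSeries m) := by
  rw [rankTailSeries_eq, rankTailSeries_eq, crankSeries_eq, map_sub, mul_sub]

theorem theorem1p4 (m : ℤ) (n : ℕ) :
    (rankCount (3 * m - 1) n : ℤ) + (rankCount (3 * m) n : ℤ) + (rankCount (3 * m + 1) n : ℤ) =
      ∑ k ∈ Finset.range (n + 1) with 3 * k ≤ n, crankCount m k * (pThree (n - 3 * k) : ℤ) := by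
  have hL : (rankCount (3 * m - 1) n : ℤ) + (rankCount (3 * m) n : ℤ) +
      (rankCount (3 * m + 1) n : ℤ) = coeff n (partitionSeries fun s =>
        3 * m - 1 ≤ multisetRank s ∧ multisetRank s ≤ 3 * m - 1 + 2) := by
    rw [series_three_ranks, map_add, map_add, ← rankCount_eq, ← rankCount_eq, ← rankCount_eq]
    ring_nf
  rw [hL]
  obtain ⟨d, rfl | rfl⟩ := m.eq_nat_or_neg
  · rw [sum_crankCount_mul_pThree (crankCount_natCast d), ← rankTailSeries_sub_eq,
      rankTailSeries_sub]
  · rw [sum_crankCount_mul_pThree (crankCount_neg d), ← rankTailSeries_sub_eq,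
      ← rankLowerTailSeries_eq, ← rankLowerTailSeries_eq, rankLowerTailSeries_sub]
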